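/- Let $q$ be a prime power, let $r\ge 1$, and let $\delta\in\mathbb F_{q^2}$ satisfy $\delta^{q+1}=-1$. Let $\mathcal H_r=V(X_0^{q+1}+X_1^{q+1}+\cdots+X_{r+1}^{q+1})\subset\mathbb P^{r+1}$ be the Hermitian hypersurface, and call the $\mathbb F_{q^2}$-rational points of $\mathcal H_r$ with $X_0\ne 0$, normalized by $X_0=1$, its affine points. Put $U=\delta X_{r-1}-X_r$ (so $U=\delta-X_1$ if $r=1$), and let $C_1$ be the linear code over $\mathbb F_{q^2}$, with coordinates indexed by the affine points, that consists of the evaluations at these points of all polynomials of total degree at most $1$ in the $r+1$ functions $X_1,\ldots,X_{r-1},U,X_{r+1}$, with coefficients in $\mathbb F_{q^2}$. Then $C_1$ has length $$n=q^{2r+1}-(-1)^{r+1}q^r,$$ dimension $k=r+2$ over $\mathbb F_{q^2}$, and minimum distance (the least Hamming distance between distinct codewords) $$d=\begin{cases} q^{2r+1}-q^{2r-1} & \text{if } r \text{ is even},\\ q^{2r+1}-q^{2r-1}-q^r-q^{r-1} & \text{if } r\text{ is odd}.\end{cases}$$ -/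

import Mathlib

open scoped LinearAlgebra.Projectivization

namespace HermitianCode

variable {F : Type*} [Field F]

/-- The form `X_0^(q+1) + ... + X_{r+1}^(q+1)`. -/
noncomputable def form (F : Type*) [Field F] (q r : ℕ) : MvPolynomial (Fin (r + 2)) F :=
  ∑ i, MvPolynomial.X i ^ (q + 1)

/-- The `F`-rational points of the Hermitian hypersurface in `ℙ^(r+1)`. The condition does not
depend on the representative, see `mk_mem_hypersurface`. -/
def hypersurface (F : Type*) [Field F] (q r : ℕ) : Set (ℙ F (Fin (r + 2) → F)) :=
  {P | MvPolynomial.eval P.rep (form F q r) = 0}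

/-- The affine rational points: those off the hyperplane at infinity `X_0 = 0`. -/
def AffinePoints (F : Type*) [Field F] (q r : ℕ) : Type _ :=
  {P : ℙ F (Fin (r + 2) → F) // P ∈ hypersurface F q r ∧ P.rep 0 ≠ 0}

/-- The value at an affine point of the coordinate `X_i`, dehomogenized by `X_0 = 1`. -/
noncomputable def coord {q r : ℕ} (i : Fin (r + 2)) (P : AffinePoints F q r) : F :=
  P.1.rep i / P.1.rep 0

/-- The coordinate functions `X_1, ..., X_{r-1}, U, X_{r+1}` (in this order) on the affine
points, where `U = δ X_{r-1} - X_r`. (For `r = 1`, `X_{r-1} = X_0 = 1`.) -/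
noncomputable def gen {q r : ℕ} (δ : F) (j : Fin (r + 1)) (P : AffinePoints F q r) : F :=
  if (j : ℕ) + 1 = r then δ * coord ⟨r - 1, by omega⟩ P - coord ⟨r, by omega⟩ P
  else coord j.succ P

/-- Evaluation of polynomials in `X_1, ..., X_{r-1}, U, X_{r+1}` at all affine points. -/
noncomputable def evalMap (q r : ℕ) (δ : F) :
    MvPolynomial (Fin (r + 1)) F →ₗ[F] (AffinePoints F q r → F) :=
  LinearMap.pi fun P => (MvPolynomial.aeval fun j => gen δ j P).toLinearMap

/-- The code `C_a`: evaluations of the polynomials of total degree at most `a` in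
`X_1, ..., X_{r-1}, U, X_{r+1}` at the affine rational points. -/
noncomputable def code (q r : ℕ) (δ : F) (a : ℕ) : Submodule F (AffinePoints F q r → F) :=
  (MvPolynomial.restrictTotalDegree (Fin (r + 1)) F a).map (evalMap q r δ)

instance {q r : ℕ} [Finite F] : Finite (AffinePoints F q r) :=
  inferInstanceAs (Finite {P : ℙ F (Fin (r + 2) → F) // P ∈ hypersurface F q r ∧ P.rep 0 ≠ 0})

noncomputable instance {q r : ℕ} [Finite F] : Fintype (AffinePoints F q r) :=
  Fintype.ofFinite _

/-- `d` is the minimum distance of `C`: the least Hamming distance between distinct codewords. -/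
def IsMinDistance {ι : Type*} [Fintype ι] [DecidableEq F] (C : Submodule F (ι → F)) (d : ℕ) :
    Prop :=
  IsLeast {m : ℕ | ∃ x ∈ C, ∃ y ∈ C, x ≠ y ∧ hammingDist x y = m} d

theorem mk_mem_hypersurface {q r : ℕ} (v : Fin (r + 2) → F) (hv : v ≠ 0) :
    Projectivization.mk F v hv ∈ hypersurface F q r ↔ ∑ i, v i ^ (q + 1) = 0 := by
  obtain ⟨a, ha⟩ := Projectivization.exists_smul_eq_mk_rep F v hv
  simp [hypersurface, form, ← ha, Units.smul_def, mul_pow, ← Finset.mul_sum]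

end HermitianCode

/-!
The form `H x = ∑ N(x_i)`, with `N` the norm of `F` over its subfield `K` of `q` elements, takes
values in `K`, and the affine points are the solutions of `H x = -1` in `F ^ (r + 1)`. Since `U`
replaces `X_r` by `δ X_{r-1} - X_r`, the words of degree at most one are, whatever `δ` is, the
linear forms `b + a ⬝ᵥ x`, and their weights are found by counting the solutions of
`H x = -1`, `b + a ⬝ᵥ x = 0`.

To count, detect the first equation with a primitive additive character `ψ` of `K` and the second
one with its composite with the trace. Completing the square reduces every exponential sum to the
one-variable sum `∑ ψ(t N(x)) = -q`, valid for all `t ≠ 0`. The trivial character gives the main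
term. The remaining characters give `(-q) ^ (r + 1) / q ^ 3` times an error that lies between
`-q ^ 2` and `q`, and both ends are attained by hyperplanes through the origin, isotropic
(`H a = 0`) for `-q ^ 2` and nonisotropic for `q`. The sign `(-1) ^ (r + 1)` decides which end
gives the most zeros, whence the two cases for the minimum distance.
-/

namespace HermitianCode

section FiniteField

theorem exists_subfield_natCard_eq {F : Type*} [Field F] [Finite F] {q n : ℕ} (hn : n ≠ 0)
    (hF : Nat.card F = q ^ n) : ∃ K : Subfield F, Nat.card K = q := by
  have := Fintype.ofFinite F
  obtain ⟨p, hchar, m, hp, hm⟩ := FiniteField.card' F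
  have : Fact p.Prime := ⟨hp⟩
  rw [Fintype.card_eq_nat_card] at hm
  obtain ⟨k, -, rfl⟩ := (Nat.dvd_prime_pow hp).1 (hm ▸ hF ▸ dvd_pow_self q hn)
  have hmk : (m : ℕ) = k * n :=
    Nat.pow_right_injective hp.two_le (by simpa only [pow_mul, hm] using hF)
  have hk : k ≠ 0 := left_ne_zero_of_mul (hmk ▸ m.ne_zero)
  let := ZMod.algebra F p
  have hfinrank : Module.finrank (ZMod p) F = m :=
    Nat.pow_right_injective hp.two_le ((FiniteField.pow_finrank_eq_natCard p F).trans hm)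
  obtain ⟨f⟩ := FiniteField.nonempty_algHom_of_finrank_dvd
    (F := ZMod p) (K := GaloisField p k) (L := F)
    (by rw [GaloisField.finrank p hk, hfinrank, hmk]; exact dvd_mul_right k n)
  refine ⟨f.toRingHom.fieldRange, ?_⟩
  rw [← GaloisField.card p k hk]
  exact Nat.card_congr f.toRingHom.rangeRestrictFieldEquiv.toEquiv.symm

theorem norm_smul {K F : Type*} [Field K] [Ring F] [Algebra K F] (t : K) (x : F) :
    Algebra.norm K (t • x) = t ^ Module.finrank K F * Algebra.norm K x := by
  rw [Algebra.smul_def, map_mul, Algebra.norm_algebraMap]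

theorem sum_comp_mul_norm {K F M : Type*} [Field K] [Field F] [Fintype F] [Algebra K F]
    [AddCommMonoid M] (f : K → M) {t : K} (ht : t ≠ 0) :
    ∑ x : F, f (t * Algebra.norm K x) = ∑ x : F, f (Algebra.norm K x) := by
  obtain ⟨y, rfl⟩ := FiniteField.norm_surjective K F t
  have hy : y ≠ 0 := Algebra.norm_ne_zero_iff.1 ht
  simp only [← map_mul]
  exact Equiv.sum_comp (Equiv.mulLeft₀ y hy) fun x => f (Algebra.norm K x)

variable {K F : Type*} [Field K] [Fintype K] [Field F] [Algebra K F]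

theorem isQuadraticExtension_of_card_eq_sq [Fintype F]
    (hF : Fintype.card F = Fintype.card K ^ 2) : Algebra.IsQuadraticExtension K F where
  finrank_eq_two' := Nat.pow_right_injective (Fintype.one_lt_card (α := K))
    (Module.card_eq_pow_finrank.symm.trans hF)

theorem add_pow_card (x y : F) :
    (x + y) ^ Fintype.card K = x ^ Fintype.card K + y ^ Fintype.card K :=
  map_add (FiniteField.frobeniusAlgHom K F) x y

theorem smul_pow_card (t : K) (x : F) : (t • x) ^ Fintype.card K = t • x ^ Fintype.card K :=
  map_smul (FiniteField.frobeniusAlgHom K F) t x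

theorem norm_pow_card (x : F) : Algebra.norm K (x ^ Fintype.card K) = Algebra.norm K x := by
  rw [map_pow, FiniteField.pow_card]

end FiniteField

section QuadraticExtension

variable {K F : Type*} [Field K] [Fintype K] [Field F] [Algebra K F]
  [Algebra.IsQuadraticExtension K F]

variable (K F) in
theorem card_eq_sq_of_isQuadraticExtension [Fintype F] :
    Fintype.card F = Fintype.card K ^ 2 := by
  rw [Module.card_eq_pow_finrank (K := K), Algebra.IsQuadraticExtension.finrank_eq_two]

theorem pow_card_pow_card (x : F) : (x ^ Fintype.card K) ^ Fintype.card K = x := by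
  have := Module.finite_of_finite K (M := F)
  have := Fintype.ofFinite F
  rw [← pow_mul, ← sq, ← card_eq_sq_of_isQuadraticExtension K F, FiniteField.pow_card]

theorem algebraMap_norm_eq_pow (x : F) :
    algebraMap K F (Algebra.norm K x) = x ^ (Fintype.card K + 1) := by
  have := Module.finite_of_finite K (M := F)
  rw [FiniteField.algebraMap_norm_eq_pow_sum, Algebra.IsQuadraticExtension.finrank_eq_two,
    Fintype.card_eq_nat_card, Finset.sum_range_succ, Finset.sum_range_one, pow_zero, pow_one,
    add_comm]

theorem algebraMap_trace_eq_add_pow (x : F) :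
    algebraMap K F (Algebra.trace K F x) = x + x ^ Fintype.card K := by
  have := Module.finite_of_finite K (M := F)
  rw [FiniteField.algebraMap_trace_eq_sum_pow, Algebra.IsQuadraticExtension.finrank_eq_two,
    Fintype.card_eq_nat_card, Finset.sum_range_succ, Finset.sum_range_one, pow_zero, pow_one,
    pow_one]

theorem norm_add (x y : F) :
    Algebra.norm K (x + y) =
      Algebra.norm K x + Algebra.norm K y + Algebra.trace K F (y ^ Fintype.card K * x) := by
  apply (algebraMap K F).injective
  simp only [map_add, algebraMap_norm_eq_pow, algebraMap_trace_eq_add_pow, pow_succ, mul_pow,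
    pow_card_pow_card, add_pow_card]
  ring

theorem mul_norm_add_trace_eq_completed_square {t : K} (ht : t ≠ 0) (b x : F) :
    t * Algebra.norm K x + Algebra.trace K F (b * x) =
      t * Algebra.norm K (x + t⁻¹ • b ^ Fintype.card K) - Algebra.norm K b / t := by
  rw [norm_add, norm_smul, Algebra.IsQuadraticExtension.finrank_eq_two, norm_pow_card,
    smul_pow_card, pow_card_pow_card, smul_mul_assoc, map_smul, smul_eq_mul]
  field_simp
  ring

end QuadraticExtension

section CharacterSum

variable {K R : Type*} [Field K] [CommRing R] {ψ : AddChar K R}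

theorem addChar_map_sum {ι : Type*} (s : Finset ι) (f : ι → K) :
    ψ (∑ i ∈ s, f i) = ∏ i ∈ s, ψ (f i) :=
  map_prod ψ.toMonoidHom (fun i => Multiplicative.ofAdd (f i)) s

theorem isPrimitive_comp_trace {F : Type*} [Field F] [Algebra K F] [FiniteDimensional K F]
    [Algebra.IsSeparable K F] (hψ : ψ.IsPrimitive) :
    (ψ.compAddMonoidHom (Algebra.trace K F).toAddMonoidHom).IsPrimitive := by
  refine AddChar.IsPrimitive.of_ne_one fun h => hψ one_ne_zero (DFunLike.ext _ _ fun t => ?_)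
  obtain ⟨x, rfl⟩ := Algebra.trace_surjective K F t
  simpa using DFunLike.congr_fun h x

variable [IsDomain R]

theorem sum_addChar_trace_mul {F : Type*} [Field F] [Fintype F] [DecidableEq F] [Algebra K F]
    (hψ : ψ.IsPrimitive) (c : F) :
    ∑ x : F, ψ (Algebra.trace K F (x * c)) = if c = 0 then (Fintype.card F : R) else 0 := by
  have := Finite.of_injective _ (algebraMap K F).injective
  exact (AddChar.sum_mulShift c (isPrimitive_comp_trace (F := F) hψ)).trans
    (by rw [Nat.cast_ite, Nat.cast_zero])

variable [Fintype K]

theorem sum_erase_zero_addChar_mul [DecidableEq K] (hψ : ψ.IsPrimitive) (c : K) :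
    ∑ t ∈ Finset.univ.erase 0, ψ (t * c) = (if c = 0 then (Fintype.card K : R) else 0) - 1 := by
  rw [Finset.sum_erase_eq_sub (Finset.mem_univ 0), AddChar.sum_mulShift c hψ, zero_mul,
    AddChar.map_zero_eq_one, Nat.cast_ite, Nat.cast_zero]

variable {F : Type*} [Field F] [Fintype F] [Algebra K F]
  [Algebra.IsQuadraticExtension K F] [CharZero R]

theorem sum_addChar_mul_norm (hψ : ψ.IsPrimitive) {t : K} (ht : t ≠ 0) :
    ∑ x : F, ψ (t * Algebra.norm K x) = -(Fintype.card K : R) := by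
  classical
  rw [sum_comp_mul_norm ψ ht]
  have sum_all : ∑ s : K, ∑ x : F, ψ (s * Algebra.norm K x) = Fintype.card K := by
    rw [Finset.sum_comm]
    simp [AddChar.sum_mulShift _ hψ]
  have sum_ne_zero : ∑ s ∈ Finset.univ.erase (0 : K), ∑ x : F, ψ (s * Algebra.norm K x) =
      (Fintype.card K - 1) * ∑ x : F, ψ (Algebra.norm K x) := by
    rw [Finset.sum_congr rfl fun s hs => sum_comp_mul_norm ψ (Finset.ne_of_mem_erase hs),
      Finset.sum_const, nsmul_eq_mul, Finset.card_erase_of_mem (Finset.mem_univ _),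
      Finset.card_univ, Nat.cast_pred Fintype.card_pos]
  have sum_zero : ∑ x : F, ψ (0 * Algebra.norm K x) = (Fintype.card K : R) ^ 2 := by
    simp [card_eq_sq_of_isQuadraticExtension K F]
  have card_sub_one_ne_zero : (Fintype.card K : R) - 1 ≠ 0 :=
    sub_ne_zero.2 (Nat.cast_ne_one.2 Fintype.one_lt_card.ne')
  apply mul_left_cancel₀ card_sub_one_ne_zero
  rw [← sum_ne_zero, Finset.sum_erase_eq_sub (Finset.mem_univ 0), sum_all, sum_zero]
  ring

theorem sum_addChar_mul_norm_add_trace (hψ : ψ.IsPrimitive) {t : K} (ht : t ≠ 0) (b : F) :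
    ∑ x : F, ψ (t * Algebra.norm K x + Algebra.trace K F (b * x)) =
      -(Fintype.card K : R) * ψ (-(Algebra.norm K b / t)) := by
  simp only [mul_norm_add_trace_eq_completed_square ht, sub_eq_add_neg, AddChar.map_add_eq_mul]
  rw [← Finset.sum_mul, ← sum_addChar_mul_norm (F := F) hψ ht]
  congr 1
  exact Equiv.sum_comp (Equiv.addRight (t⁻¹ • b ^ Fintype.card K)) fun x => ψ (t * Algebra.norm K x)

end CharacterSum

section HermitianForm

variable {K F ι : Type*} [Field K] [Field F] [Algebra K F] [Fintype ι]

variable (K) in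
/-- The diagonal Hermitian form `∑ x_i ^ (q + 1)` on `F ^ ι`. It is written as a sum of norms
so that its values lie in the field `K` with `q` elements rather than in `F`. -/
noncomputable def hermitianForm (x : ι → F) : K :=
  ∑ i, Algebra.norm K (x i)

theorem hermitianForm_smul (u : F) (x : ι → F) :
    hermitianForm K (u • x) = Algebra.norm K u * hermitianForm K x := by
  simp only [hermitianForm, Pi.smul_apply, smul_eq_mul, map_mul, Finset.mul_sum]

@[simp]
theorem hermitianForm_zero [FiniteDimensional K F] : hermitianForm K (0 : ι → F) = 0 := by
  simp [hermitianForm]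

theorem hermitianForm_cons [FiniteDimensional K F] {n : ℕ} (b : F) (a : Fin n → F) :
    hermitianForm K (Fin.cons b a : Fin (n + 1) → F) = Algebra.norm K b + hermitianForm K a := by
  simp [hermitianForm, Fin.sum_univ_succ]

theorem algebraMap_hermitianForm [Fintype K] [Algebra.IsQuadraticExtension K F] (x : ι → F) :
    algebraMap K F (hermitianForm K x) = ∑ i, x i ^ (Fintype.card K + 1) := by
  simp only [hermitianForm, map_sum, algebraMap_norm_eq_pow]

variable [Fintype F] {R : Type*} [CommRing R] [IsDomain R] {ψ : AddChar K R}

theorem sum_addChar_trace_dotProduct [DecidableEq F] [DecidableEq ι] (hψ : ψ.IsPrimitive)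
    (a : ι → F) :
    ∑ x : ι → F, ψ (Algebra.trace K F (a ⬝ᵥ x)) =
      if a = 0 then (Fintype.card F : R) ^ Fintype.card ι else 0 := by
  simp only [dotProduct, map_sum, addChar_map_sum]
  rw [← Fintype.prod_sum fun i (y : F) => ψ (Algebra.trace K F (a i * y))]
  simp only [mul_comm (a _), sum_addChar_trace_mul hψ]
  split_ifs with ha
  · simp [ha]
  · obtain ⟨i, hi⟩ := Function.ne_iff.1 ha
    exact Finset.prod_eq_zero (Finset.mem_univ i) (if_neg hi)

variable [Fintype K] [CharZero R] [Algebra.IsQuadraticExtension K F]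

theorem sum_addChar_mul_hermitianForm_add_trace [DecidableEq ι] (hψ : ψ.IsPrimitive) {t : K}
    (ht : t ≠ 0) (a : ι → F) :
    ∑ x : ι → F, ψ (t * hermitianForm K x + Algebra.trace K F (a ⬝ᵥ x)) =
      (-(Fintype.card K : R)) ^ Fintype.card ι * ψ (-(hermitianForm K a / t)) := by
  have factor (x : ι → F) : ψ (t * hermitianForm K x + Algebra.trace K F (a ⬝ᵥ x)) =
      ∏ i, ψ (t * Algebra.norm K (x i) + Algebra.trace K F (a i * x i)) := by
    rw [← addChar_map_sum, Finset.sum_add_distrib, hermitianForm, Finset.mul_sum, dotProduct,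
      map_sum]
  simp only [factor]
  rw [← Fintype.prod_sum fun i (y : F) => ψ (t * Algebra.norm K y + Algebra.trace K F (a i * y))]
  simp only [sum_addChar_mul_norm_add_trace hψ ht]
  rw [Finset.prod_mul_distrib, Finset.prod_const, Finset.card_univ, ← addChar_map_sum,
    Finset.sum_neg_distrib, hermitianForm, Finset.sum_div]

end HermitianForm

section SectionError

variable {K F ι : Type*} [Field K] [Fintype K] [DecidableEq K] [Field F] [DecidableEq F]
  [Algebra K F] [Fintype ι]

variable (K) in
/-- The contribution of the nontrivial characters of `K` to the number of solutions of
`H x = c`, `b + a ⬝ᵥ x = 0`, where `H` is the Hermitian form. It is normalized by the factor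
`(-q) ^ |ι| / q ^ 3`, see `card_hyperplaneSection`. -/
noncomputable def sectionError (a : ι → F) (b : F) (c : K) : ℤ :=
  let q : ℤ := Fintype.card K
  if hermitianForm K a = 0 then if b = 0 then q ^ 2 * ((if c = 0 then q else 0) - 1) else 0
  else -q * ((if Algebra.norm K b = c * hermitianForm K a then q else 0) - 1)

theorem neg_sq_le_sectionError (a : ι → F) (b : F) {c : K} (hc : c ≠ 0) :
    -(Fintype.card K : ℤ) ^ 2 ≤ sectionError K a b c := by
  have hq : (0 : ℤ) < Fintype.card K := mod_cast Fintype.card_pos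
  unfold sectionError
  split_ifs <;> nlinarith

theorem sectionError_le (a : ι → F) (b : F) {c : K} (hc : c ≠ 0) :
    sectionError K a b c ≤ Fintype.card K := by
  have hq : (0 : ℤ) < Fintype.card K := mod_cast Fintype.card_pos
  unfold sectionError
  split_ifs <;> nlinarith

end SectionError

section HyperplaneSection

variable {K F ι R : Type*} [Field K] [Fintype K] [Field F] [Fintype F] [Algebra K F]
  [Algebra.IsQuadraticExtension K F] [Fintype ι] [CommRing R] [IsDomain R] {ψ : AddChar K R}

theorem sum_addChar_section_zero [DecidableEq F] [DecidableEq ι] (hψ : ψ.IsPrimitive)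
    (a : ι → F) (b : F) (c : K) :
    ∑ u : F, ∑ x : ι → F,
        ψ (0 * (hermitianForm K x - c) + Algebra.trace K F (u * (b + a ⬝ᵥ x))) =
      (Fintype.card K : R) ^ (2 * Fintype.card ι) *
        if a = 0 then if b = 0 then (Fintype.card K : R) ^ 2 else 0 else 1 := by
  have sum_x (u : F) : ∑ x : ι → F,
        ψ (0 * (hermitianForm K x - c) + Algebra.trace K F (u * (b + a ⬝ᵥ x))) =
      ψ (Algebra.trace K F (u * b)) *
        if u • a = 0 then (Fintype.card K : R) ^ (2 * Fintype.card ι) else 0 := by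
    have expand (x : ι → F) : u * (b + a ⬝ᵥ x) = u * b + (u • a) ⬝ᵥ x := by
      rw [mul_add, smul_dotProduct, smul_eq_mul]
    simp only [zero_mul, zero_add, expand, map_add, AddChar.map_add_eq_mul]
    rw [← Finset.mul_sum, sum_addChar_trace_dotProduct hψ,
      card_eq_sq_of_isQuadraticExtension K F, Nat.cast_pow, pow_mul]
  simp only [sum_x, smul_eq_zero]
  by_cases ha : a = 0
  · simp only [ha, or_true, if_true]
    rw [← Finset.sum_mul, sum_addChar_trace_mul hψ, card_eq_sq_of_isQuadraticExtension K F,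
      Nat.cast_pow, mul_comm]
  · simp [ha]

theorem card_hyperplaneSection_eq_sum [DecidableEq K] [DecidableEq F] [DecidableEq ι]
    (hψ : ψ.IsPrimitive) (a : ι → F) (b : F) (c : K) :
    (Fintype.card K : R) ^ 3 *
        Fintype.card {x : ι → F // hermitianForm K x = c ∧ b + a ⬝ᵥ x = 0} =
      ∑ t : K, ∑ u : F, ∑ x : ι → F,
        ψ (t * (hermitianForm K x - c) + Algebra.trace K F (u * (b + a ⬝ᵥ x))) := by
  have indicator (x : ι → F) :
      ∑ t : K, ∑ u : F, ψ (t * (hermitianForm K x - c) +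
          Algebra.trace K F (u * (b + a ⬝ᵥ x))) =
        if hermitianForm K x = c ∧ b + a ⬝ᵥ x = 0 then (Fintype.card K : R) ^ 3 else 0 := by
    simp only [AddChar.map_add_eq_mul _ (_ * (_ - _))]
    rw [← Finset.sum_mul_sum, AddChar.sum_mulShift _ hψ, sum_addChar_trace_mul hψ,
      card_eq_sq_of_isQuadraticExtension K F]
    simp only [sub_eq_zero, ite_and]
    split_ifs <;> push_cast <;> ring
  rw [Finset.sum_congr rfl fun t _ => Finset.sum_comm, Finset.sum_comm]
  simp only [indicator]
  rw [← Finset.sum_filter, Finset.sum_const, nsmul_eq_mul, Fintype.card_subtype, mul_comm]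

variable [CharZero R]

theorem sum_addChar_section_of_ne_zero [DecidableEq ι] (hψ : ψ.IsPrimitive) {t : K}
    (ht : t ≠ 0) (a : ι → F) (b u : F) (c : K) :
    ∑ x : ι → F, ψ (t * (hermitianForm K x - c) + Algebra.trace K F (u * (b + a ⬝ᵥ x))) =
      (-(Fintype.card K : R)) ^ Fintype.card ι *
        (ψ (t * -c) *
          ψ (-(hermitianForm K a / t) * Algebra.norm K u + Algebra.trace K F (b * u))) := by
  have split (x : ι → F) :
      t * (hermitianForm K x - c) + Algebra.trace K F (u * (b + a ⬝ᵥ x)) =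
        t * -c + Algebra.trace K F (b * u) +
          (t * hermitianForm K x + Algebra.trace K F ((u • a) ⬝ᵥ x)) := by
    rw [smul_dotProduct, smul_eq_mul, mul_add u, map_add, mul_comm b]
    ring
  simp only [split, AddChar.map_add_eq_mul _ (t * -c + _)]
  rw [← Finset.mul_sum, sum_addChar_mul_hermitianForm_add_trace hψ ht, hermitianForm_smul,
    mul_left_comm, ← AddChar.map_add_eq_mul, ← AddChar.map_add_eq_mul]
  congr 2
  ring

variable [DecidableEq K] [DecidableEq F]

theorem sum_erase_zero_sum_addChar (hψ : ψ.IsPrimitive) (a : ι → F) (b : F) (c : K) :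
    ∑ t ∈ Finset.univ.erase (0 : K), ψ (t * -c) *
        ∑ u : F, ψ (-(hermitianForm K a / t) * Algebra.norm K u + Algebra.trace K F (b * u)) =
      sectionError K a b c := by
  by_cases hA : hermitianForm K a = 0
  · simp only [hA, zero_div, neg_zero, zero_mul, zero_add, mul_comm b, sum_addChar_trace_mul hψ]
    rw [← Finset.sum_mul, sum_erase_zero_addChar_mul hψ, card_eq_sq_of_isQuadraticExtension K F,
      sectionError, if_pos hA]
    simp only [neg_eq_zero]
    split_ifs <;> push_cast <;> ring
  · have sum_u (t : K) (ht : t ∈ Finset.univ.erase 0) :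
        ψ (t * -c) * ∑ u : F, ψ (-(hermitianForm K a / t) * Algebra.norm K u +
            Algebra.trace K F (b * u)) =
          -(Fintype.card K : R) * ψ (t * (Algebra.norm K b / hermitianForm K a - c)) := by
      have ht₀ := Finset.ne_of_mem_erase ht
      rw [sum_addChar_mul_norm_add_trace hψ (neg_ne_zero.2 (div_ne_zero hA ht₀)), mul_left_comm,
        ← AddChar.map_add_eq_mul]
      congr 2
      field_simp
      ring
    rw [Finset.sum_congr rfl sum_u, ← Finset.mul_sum, sum_erase_zero_addChar_mul hψ, sectionError,
      if_neg hA]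
    simp only [sub_eq_zero, div_eq_iff hA]
    push_cast
    rfl

theorem card_hyperplaneSection [DecidableEq ι] (a : ι → F) (b : F) (c : K) :
    (Fintype.card K : ℤ) ^ 3 *
        Fintype.card {x : ι → F // hermitianForm K x = c ∧ b + a ⬝ᵥ x = 0} =
      (Fintype.card K : ℤ) ^ (2 * Fintype.card ι) *
          (if a = 0 then if b = 0 then (Fintype.card K : ℤ) ^ 2 else 0 else 1) +
        (-(Fintype.card K : ℤ)) ^ Fintype.card ι * sectionError K a b c := by
  have hψ := AddChar.FiniteField.primitiveChar_to_Complex_isPrimitive K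
  apply Int.cast_injective (α := ℂ)
  push_cast
  rw [card_hyperplaneSection_eq_sum hψ, ← Finset.add_sum_erase _ _ (Finset.mem_univ 0),
    sum_addChar_section_zero hψ, ← sum_erase_zero_sum_addChar hψ]
  congr 1
  simp only [Finset.mul_sum]
  refine Finset.sum_congr rfl fun t ht => Finset.sum_congr rfl fun u _ => ?_
  exact sum_addChar_section_of_ne_zero hψ (Finset.ne_of_mem_erase ht) a b u c

end HyperplaneSection

section AffinePoints

variable {F : Type*} [Field F] {q r : ℕ}

theorem coord_mk {v : Fin (r + 2) → F} {hv : v ≠ 0}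
    (hP : Projectivization.mk F v hv ∈ hypersurface F q r ∧ (Projectivization.mk F v hv).rep 0 ≠ 0)
    (i : Fin (r + 2)) : coord (q := q) i ⟨Projectivization.mk F v hv, hP⟩ = v i / v 0 := by
  obtain ⟨c, hc⟩ := Projectivization.exists_smul_eq_mk_rep F v hv
  simp only [coord, ← hc, Pi.smul_apply, Units.smul_def, smul_eq_mul,
    mul_div_mul_left _ _ c.ne_zero]

theorem coord_zero (P : AffinePoints F q r) : coord 0 P = 1 :=
  div_self P.2.2

theorem coord_ne_zero (P : AffinePoints F q r) : (coord · P) ≠ 0 := fun h =>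
  one_ne_zero ((coord_zero P).symm.trans (congrFun h 0))

theorem mk_coord (P : AffinePoints F q r) :
    Projectivization.mk F (coord · P) (coord_ne_zero P) = P.1 := by
  conv_rhs => rw [← P.1.mk_rep]
  refine (Projectivization.mk_eq_mk_iff' ..).2 ⟨(P.1.rep 0)⁻¹, funext fun i => ?_⟩
  rw [Pi.smul_apply, smul_eq_mul, coord, div_eq_inv_mul]

theorem cons_one_coord_succ (P : AffinePoints F q r) :
    (Fin.cons 1 fun i : Fin (r + 1) => coord i.succ P) = (coord · P) := by
  rw [← coord_zero P]
  exact Fin.cons_self_tail (coord · P)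

theorem sum_coord_succ_pow (P : AffinePoints F q r) :
    ∑ i : Fin (r + 1), coord i.succ P ^ (q + 1) = -1 := by
  have hP : ∑ i, coord i P ^ (q + 1) = 0 := by
    rw [← mk_mem_hypersurface (fun i => coord i P) (coord_ne_zero P), mk_coord]
    exact P.2.1
  rw [Fin.sum_univ_succ, coord_zero, one_pow] at hP
  exact (neg_eq_of_add_eq_zero_right hP).symm

/-- The affine points of the Hermitian hypersurface, as the solutions of the affine equation
`∑ x_i ^ (q + 1) = -1`. -/
noncomputable def affinePointsEquiv (F : Type*) [Field F] (q r : ℕ) :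
    AffinePoints F q r ≃ {x : Fin (r + 1) → F // ∑ i, x i ^ (q + 1) = -1} where
  toFun P := ⟨fun i => coord i.succ P, sum_coord_succ_pow P⟩
  invFun x :=
    have hx : (Fin.cons 1 x.1 : Fin (r + 2) → F) ≠ 0 := fun h => one_ne_zero (congrFun h 0)
    ⟨Projectivization.mk F (Fin.cons 1 x.1) hx,
      (mk_mem_hypersurface _ hx).2 (by simp [Fin.sum_univ_succ, x.2]), by
        obtain ⟨c, hc⟩ := Projectivization.exists_smul_eq_mk_rep F _ hx
        simp [← hc, Units.smul_def]⟩
  left_inv P := Subtype.ext (by simp only [cons_one_coord_succ, mk_coord])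
  right_inv x := Subtype.ext (funext fun i => by simp [coord_mk])

end AffinePoints

section DegreeOne

theorem restrictTotalDegree_one_eq_span (σ R : Type*) [CommSemiring R] :
    MvPolynomial.restrictTotalDegree σ R 1 =
      Submodule.span R (insert 1 (Set.range MvPolynomial.X)) := by
  have exponents : {n : σ →₀ ℕ | (n.sum fun _ e => e) ≤ 1} =
      insert 0 (Set.range fun i => Finsupp.single i 1) := by
    ext n
    rw [Set.mem_ofPred_eq, Nat.le_one_iff_eq_zero_or_eq_one, Finsupp.sum_eq_one_iff]
    simp only [Set.mem_insert_iff, Set.mem_range, eq_comm (a := n)]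
    exact or_congr_left (Finsupp.degree_eq_zero_iff n |>.trans eq_comm)
  rw [MvPolynomial.restrictTotalDegree, exponents, MvPolynomial.restrictSupport_eq_span,
    Set.image_insert_eq, ← Set.range_comp]
  rfl

variable {F : Type*} [Field F] {q r : ℕ}

theorem code_one_eq_span_gen (δ : F) :
    code q r δ 1 = Submodule.span F (insert 1 (Set.range (gen δ))) := by
  have evalMap_one : evalMap q r δ 1 = 1 :=
    funext fun P => map_one (MvPolynomial.aeval fun j => gen δ j P)
  have evalMap_X (j : Fin (r + 1)) : evalMap q r δ (MvPolynomial.X j) = gen δ j :=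
    funext fun P => MvPolynomial.aeval_X _ j
  rw [code, restrictTotalDegree_one_eq_span, Submodule.map_span, Set.image_insert_eq,
    ← Set.range_comp, evalMap_one]
  simp only [Function.comp_def, evalMap_X]

theorem gen_of_add_one_eq (δ : F) {j : Fin (r + 1)} (hj : (j : ℕ) + 1 = r) :
    (gen δ j : AffinePoints F q r → F) = δ • coord j.castSucc - coord j.succ := by
  funext P
  have hpred : (⟨r - 1, by omega⟩ : Fin (r + 2)) = j.castSucc := Fin.ext (by simp; omega)
  have hr : (⟨r, by omega⟩ : Fin (r + 2)) = j.succ := Fin.ext (by simp; omega)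
  simp [gen, hj, hpred, hr]

theorem gen_of_add_one_ne (δ : F) {j : Fin (r + 1)} (hj : (j : ℕ) + 1 ≠ r) :
    (gen δ j : AffinePoints F q r → F) = coord j.succ :=
  funext fun _ => if_neg hj

theorem code_one_eq_span_coord (δ : F) :
    code q r δ 1 = Submodule.span F (Set.range coord) := by
  rw [code_one_eq_span_gen]
  have coord_zero_eq_one : (coord 0 : AffinePoints F q r → F) = 1 := funext coord_zero
  apply le_antisymm <;> rw [Submodule.span_le]
  · have coord_mem (i : Fin (r + 2)) : (coord i : AffinePoints F q r → F) ∈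
        Submodule.span F (Set.range coord) := Submodule.subset_span ⟨i, rfl⟩
    rintro _ (rfl | ⟨j, rfl⟩)
    · exact coord_zero_eq_one ▸ coord_mem 0
    · by_cases hj : (j : ℕ) + 1 = r
      · rw [gen_of_add_one_eq δ hj]
        exact sub_mem (Submodule.smul_mem _ _ (coord_mem _)) (coord_mem _)
      · rw [gen_of_add_one_ne δ hj]
        exact coord_mem _
  · rintro _ ⟨i, rfl⟩
    induction i using Fin.induction with
    | zero => exact Submodule.subset_span (Or.inl coord_zero_eq_one)
    | succ j ih =>
      have gen_mem : gen δ j ∈ Submodule.span F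
          (insert (1 : AffinePoints F q r → F) (Set.range (gen δ))) :=
        Submodule.subset_span (Or.inr ⟨j, rfl⟩)
      by_cases hj : (j : ℕ) + 1 = r
      · rw [gen_of_add_one_eq δ hj] at gen_mem
        exact (Submodule.sub_mem_iff_right _ (Submodule.smul_mem _ δ ih)).1 gen_mem
      · exact gen_of_add_one_ne (q := q) δ hj ▸ gen_mem

end DegreeOne

section MinDistance

theorem hammingNorm_add_card_zeros {ι R : Type*} [Fintype ι] [DecidableEq R] [Zero R]
    (w : ι → R) : hammingNorm w + Fintype.card {i // w i = 0} = Fintype.card ι := by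
  rw [hammingNorm, Fintype.card_subtype, add_comm, ← Finset.card_univ]
  exact Finset.card_filter_add_card_filter_not (s := Finset.univ) (fun i => w i = 0)

theorem isMinDistance_iff {F ι : Type*} [Field F] [DecidableEq F] [Fintype ι]
    {C : Submodule F (ι → F)} {d : ℕ} :
    IsMinDistance C d ↔ IsLeast {m | ∃ w ∈ C, w ≠ 0 ∧ hammingNorm w = m} d := by
  suffices h : {m | ∃ x ∈ C, ∃ y ∈ C, x ≠ y ∧ hammingDist x y = m} =
      {m | ∃ w ∈ C, w ≠ 0 ∧ hammingNorm w = m} by rw [IsMinDistance, h]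
  ext m
  constructor
  · rintro ⟨x, hx, y, hy, hxy, rfl⟩
    exact ⟨-x + y, add_mem (neg_mem hx) hy, fun h => hxy (neg_add_eq_zero.1 h),
      (hammingDist_eq_hammingNorm x y).symm⟩
  · rintro ⟨w, hw, hw₀, rfl⟩
    exact ⟨w, hw, 0, zero_mem C, hw₀, hammingDist_zero_right w⟩

/-- The minimum distance of the code of degree one, for `r ≥ 1`; at `r = 0` the subtractions in
the exponents truncate. -/
def minDist (q r : ℕ) : ℤ :=
  if Even r then (q : ℤ) ^ (2 * r + 1) - (q : ℤ) ^ (2 * r - 1)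
  else (q : ℤ) ^ (2 * r + 1) - (q : ℤ) ^ (2 * r - 1) - (q : ℤ) ^ r - (q : ℤ) ^ (r - 1)

theorem cube_mul_minDist (q : ℕ) {r : ℕ} (hr : 1 ≤ r) :
    (q : ℤ) ^ 3 * minDist q r = (q : ℤ) ^ (2 * r + 2) * ((q : ℤ) ^ 2 - 1) -
      if Even r then 0 else (q : ℤ) ^ (r + 1) * (q ^ 2 + q) := by
  obtain ⟨k, rfl⟩ := Nat.exists_eq_add_of_le' hr
  rw [minDist, show 2 * (k + 1) - 1 = 2 * k + 1 by omega, Nat.add_sub_cancel]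
  split_ifs <;> ring

theorem minDist_pos {q r : ℕ} (hq : 2 ≤ q) (hr : 1 ≤ r) : 0 < minDist q r := by
  obtain ⟨k, rfl⟩ := Nat.exists_eq_add_of_le' hr
  have two_le_q : (2 : ℤ) ≤ q := mod_cast hq
  rw [minDist, show 2 * (k + 1) - 1 = 2 * k + 1 by omega, Nat.add_sub_cancel]
  split_ifs
  · rw [sub_pos]
    exact pow_lt_pow_right₀ (one_lt_two.trans_le two_le_q) (by omega)
  · have factor : (q : ℤ) ^ (2 * (k + 1) + 1) - (q : ℤ) ^ (2 * k + 1) - (q : ℤ) ^ (k + 1) -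
        (q : ℤ) ^ k = (q : ℤ) ^ k * (q + 1) * ((q : ℤ) ^ k * (q * (q - 1)) - 1) := by ring
    have one_le_pow : 1 ≤ (q : ℤ) ^ k := one_le_pow₀ (by linarith)
    have two_le_mul : (2 : ℤ) ≤ q * (q - 1) := by nlinarith
    have last_factor_pos : 0 < (q : ℤ) ^ k * (q * (q - 1)) - 1 := by nlinarith
    rw [factor]
    positivity

end MinDistance

section LinearForm

variable {F : Type*} [Field F]

/-- The evaluation of the linear form `∑ v_i X_i` in the homogeneous coordinates at the affine
points, where `X_0 = 1`. -/
noncomputable def linearFormEval (F : Type*) [Field F] (q r : ℕ) :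
    (Fin (r + 2) → F) →ₗ[F] (AffinePoints F q r → F) :=
  Fintype.linearCombination F coord

theorem linearFormEval_apply {q r : ℕ} (v : Fin (r + 2) → F) (P : AffinePoints F q r) :
    linearFormEval F q r v P = v 0 + Fin.tail v ⬝ᵥ fun i => coord i.succ P := by
  simp [linearFormEval, Fintype.linearCombination_apply, Fin.sum_univ_succ, coord_zero,
    dotProduct, Fin.tail]

theorem code_one_eq_range_linearFormEval {q r : ℕ} (δ : F) :
    code q r δ 1 = LinearMap.range (linearFormEval F q r) := by
  rw [code_one_eq_span_coord, linearFormEval, Fintype.range_linearCombination]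

variable {K : Type*} [Field K] [Fintype K] [Algebra K F] [Algebra.IsQuadraticExtension K F]

theorem hermitianForm_eq_neg_one_iff {ι : Type*} [Fintype ι] (x : ι → F) :
    hermitianForm K x = -1 ↔ ∑ i, x i ^ (Fintype.card K + 1) = -1 := by
  rw [← algebraMap_hermitianForm, ← (algebraMap K F).injective.eq_iff, map_neg, map_one]

variable {r : ℕ}

theorem card_zeros_linearFormEval [Fintype F] [DecidableEq F] [DecidableEq K]
    (v : Fin (r + 2) → F) :
    Fintype.card {P // linearFormEval F (Fintype.card K) r v P = 0} =
      Fintype.card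
        {x : Fin (r + 1) → F // hermitianForm K x = -1 ∧ v 0 + Fin.tail v ⬝ᵥ x = 0} := by
  simp only [linearFormEval_apply, hermitianForm_eq_neg_one_iff]
  exact Fintype.card_congr <|
    ((affinePointsEquiv F _ r).subtypeEquiv (q := fun x => v 0 + Fin.tail v ⬝ᵥ x.1 = 0)
      fun _ => Iff.rfl).trans
    (Equiv.subtypeSubtypeEquivSubtypeInter _ fun x => v 0 + Fin.tail v ⬝ᵥ x = 0)

variable [Finite F]

theorem cube_mul_card_zeros_linearFormEval [DecidableEq F] [DecidableEq K] (v : Fin (r + 2) → F) :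
    (Fintype.card K : ℤ) ^ 3 *
        Fintype.card {P // linearFormEval F (Fintype.card K) r v P = 0} =
      (Fintype.card K : ℤ) ^ (2 * r + 2) *
          (if Fin.tail v = 0 then if v 0 = 0 then (Fintype.card K : ℤ) ^ 2 else 0 else 1) +
        (-(Fintype.card K : ℤ)) ^ (r + 1) * sectionError K (Fin.tail v) (v 0) (-1) := by
  have := Fintype.ofFinite F
  rw [card_zeros_linearFormEval, card_hyperplaneSection, Fintype.card_fin]
  rfl

variable (F K r) in
theorem card_affinePoints :
    (Fintype.card (AffinePoints F (Fintype.card K) r) : ℤ) =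
      (Fintype.card K : ℤ) ^ (2 * r + 1) - (-1) ^ (r + 1) * (Fintype.card K : ℤ) ^ r := by
  classical
  have card_ne_zero : (Fintype.card K : ℤ) ≠ 0 := mod_cast Fintype.card_ne_zero
  have zeros := cube_mul_card_zeros_linearFormEval (K := K) (0 : Fin (r + 2) → F)
  have tail_zero : Fin.tail (0 : Fin (r + 2) → F) = 0 := rfl
  have all_zeros : Fintype.card {P // linearFormEval F (Fintype.card K) r 0 P = 0} =
      Fintype.card (AffinePoints F (Fintype.card K) r) := by
    simp
  rw [all_zeros, tail_zero, sectionError, hermitianForm_zero] at zeros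
  apply mul_left_cancel₀ (pow_ne_zero 3 card_ne_zero)
  simp only [Pi.zero_apply, if_true, neg_eq_zero, one_ne_zero, if_false] at zeros
  rw [zeros, neg_pow]
  ring

theorem cube_mul_hammingNorm_linearFormEval [DecidableEq F] [DecidableEq K]
    {v : Fin (r + 2) → F} (hv : v ≠ 0) :
    (Fintype.card K : ℤ) ^ 3 * hammingNorm (linearFormEval F (Fintype.card K) r v) =
      (Fintype.card K : ℤ) ^ (2 * r + 2) *
          ((Fintype.card K : ℤ) ^ 2 - if Fin.tail v = 0 then 0 else 1) -
        (-(Fintype.card K : ℤ)) ^ (r + 1) *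
          ((Fintype.card K : ℤ) ^ 2 + sectionError K (Fin.tail v) (v 0) (-1)) := by
  have zeros := cube_mul_card_zeros_linearFormEval (K := K) v
  have head_ne_zero (h : Fin.tail v = 0) : v 0 ≠ 0 := fun h₀ =>
    hv (funext (Fin.cases h₀ (congrFun h)))
  have weight : (hammingNorm (linearFormEval F (Fintype.card K) r v) : ℤ) +
      Fintype.card {P // linearFormEval F (Fintype.card K) r v P = 0} =
        Fintype.card (AffinePoints F (Fintype.card K) r) := mod_cast hammingNorm_add_card_zeros _
  rw [card_affinePoints] at weight
  rw [eq_sub_of_add_eq weight, mul_sub, zeros, neg_pow]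
  split_ifs with h h₀
  · exact absurd h₀ (head_ne_zero h)
  all_goals ring

variable (K) in
theorem minDist_le_hammingNorm [DecidableEq F] (hr : 1 ≤ r) {v : Fin (r + 2) → F} (hv : v ≠ 0) :
    minDist (Fintype.card K) r ≤ hammingNorm (linearFormEval F (Fintype.card K) r v) := by
  classical
  have card_pos : (0 : ℤ) < Fintype.card K := mod_cast Fintype.card_pos
  have error_ge := neg_sq_le_sectionError (K := K) (Fin.tail v) (v 0) (neg_ne_zero.2 one_ne_zero)
  have error_le := sectionError_le (K := K) (Fin.tail v) (v 0) (neg_ne_zero.2 one_ne_zero)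
  have indicator_le : (if Fin.tail v = 0 then 0 else 1 : ℤ) ≤ 1 := by split_ifs <;> norm_num
  apply le_of_mul_le_mul_left _ (pow_pos card_pos 3)
  rw [cube_mul_minDist _ hr, cube_mul_hammingNorm_linearFormEval hv]
  refine sub_le_sub
    (mul_le_mul_of_nonneg_left (sub_le_sub_left indicator_le _) (pow_pos card_pos _).le) ?_
  split_ifs with h
  · rw [h.add_one.neg_pow, neg_mul]
    exact neg_nonpos.2 (mul_nonneg (pow_pos card_pos _).le (by linarith))
  · rw [(Nat.not_even_iff_odd.1 h).add_one.neg_pow]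
    exact mul_le_mul_of_nonneg_left (by linarith) (pow_pos card_pos _).le

variable (K) in
theorem exists_hammingNorm_eq_minDist [DecidableEq F] (hr : 1 ≤ r) :
    ∃ v : Fin (r + 2) → F, v ≠ 0 ∧
      (hammingNorm (linearFormEval F (Fintype.card K) r v) : ℤ) = minDist (Fintype.card K) r := by
  classical
  have card_ne_zero : (Fintype.card K : ℤ) ≠ 0 := mod_cast Fintype.card_ne_zero
  obtain ⟨k, rfl⟩ := Nat.exists_eq_add_of_le' hr
  by_cases h : Even (k + 1)
  · obtain ⟨ε, hε⟩ := FiniteField.norm_surjective K F (-1)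
    let v : Fin (k + 3) → F := Fin.cons 0 (Fin.cons 1 (Fin.cons ε 0))
    have isotropic : hermitianForm K (Fin.tail v) = 0 := by
      simp [v, hermitianForm_cons, hε]
    have tail_ne_zero : Fin.tail v ≠ 0 := fun h => one_ne_zero (congrFun h 0)
    have hv : v ≠ 0 := fun h => one_ne_zero (congrFun h 1)
    refine ⟨v, hv, mul_left_cancel₀ (pow_ne_zero 3 card_ne_zero) ?_⟩
    rw [cube_mul_hammingNorm_linearFormEval hv, cube_mul_minDist _ hr, if_pos h, sectionError,
      if_pos isotropic, if_neg tail_ne_zero]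
    simp [v]
  · let v : Fin (k + 3) → F := Fin.cons 0 (Fin.cons 1 0)
    have nonisotropic : hermitianForm K (Fin.tail v) = 1 := by
      simp [v, hermitianForm_cons]
    have tail_ne_zero : Fin.tail v ≠ 0 := fun h => one_ne_zero (congrFun h 0)
    have hv : v ≠ 0 := fun h => one_ne_zero (congrFun h 1)
    refine ⟨v, hv, mul_left_cancel₀ (pow_ne_zero 3 card_ne_zero) ?_⟩
    rw [cube_mul_hammingNorm_linearFormEval hv, cube_mul_minDist _ hr, if_neg h, sectionError,
      nonisotropic, if_neg tail_ne_zero, (Nat.not_even_iff_odd.1 h).add_one.neg_pow]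
    simp [v]

variable (K) in
theorem linearFormEval_injective (hr : 1 ≤ r) :
    Function.Injective (linearFormEval F (Fintype.card K) r) := by
  classical
  refine (injective_iff_map_eq_zero _).2 fun v eval_zero => ?_
  by_contra hv
  have weight_pos := (minDist_pos (Fintype.one_lt_card (α := K)) hr).trans_le
    (minDist_le_hammingNorm K hr hv)
  simp [eval_zero] at weight_pos

variable (K) in
theorem finrank_code_one (hr : 1 ≤ r) (δ : F) :
    Module.finrank F (code (Fintype.card K) r δ 1) = r + 2 := by
  rw [code_one_eq_range_linearFormEval,
    LinearMap.finrank_range_of_inj (linearFormEval_injective K hr), Module.finrank_fin_fun]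

variable (K) in
theorem exists_isMinDistance_code_one [DecidableEq F] (hr : 1 ≤ r) (δ : F) :
    ∃ d : ℕ, IsMinDistance (code (Fintype.card K) r δ 1) d ∧
      (d : ℤ) = minDist (Fintype.card K) r := by
  obtain ⟨v, hv, weight_eq⟩ := exists_hammingNorm_eq_minDist (F := F) K hr
  refine ⟨_, isMinDistance_iff.2 ⟨⟨linearFormEval F _ r v, ?_, ?_, rfl⟩, ?_⟩, weight_eq⟩
  · rw [code_one_eq_range_linearFormEval]
    exact LinearMap.mem_range_self _ v
  · exact (map_ne_zero_iff _ (linearFormEval_injective K hr)).2 hv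
  · rintro _ ⟨w, hw, hw₀, rfl⟩
    rw [code_one_eq_range_linearFormEval] at hw
    obtain ⟨u, rfl⟩ := hw
    have hu : u ≠ 0 := fun h => hw₀ (h ▸ map_zero _)
    exact_mod_cast weight_eq.trans_le (minDist_le_hammingNorm K hr hu)

end LinearForm

end HermitianCode

theorem mainTheorem4_general {F : Type*} [Field F] [Fintype F] [DecidableEq F] (q r : ℕ)
    (hF : Fintype.card F = q ^ 2) (hr : 1 ≤ r) (δ : F) :
    (Fintype.card (HermitianCode.AffinePoints F q r) : ℤ)
        = (q : ℤ) ^ (2 * r + 1) - (-1) ^ (r + 1) * (q : ℤ) ^ r ∧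
    Module.finrank F (HermitianCode.code q r δ 1) = r + 2 ∧
    ∃ d : ℕ, HermitianCode.IsMinDistance (HermitianCode.code q r δ 1) d ∧
      (d : ℤ) = if Even r then (q : ℤ) ^ (2 * r + 1) - (q : ℤ) ^ (2 * r - 1)
        else (q : ℤ) ^ (2 * r + 1) - (q : ℤ) ^ (2 * r - 1) - (q : ℤ) ^ r - (q : ℤ) ^ (r - 1) := by
  obtain ⟨K, hK⟩ := HermitianCode.exists_subfield_natCard_eq two_ne_zero
    (Nat.card_eq_fintype_card.trans hF)
  have := Fintype.ofFinite K
  obtain rfl : Fintype.card K = q := Nat.card_eq_fintype_card.symm.trans hK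
  have := HermitianCode.isQuadraticExtension_of_card_eq_sq hF
  exact ⟨HermitianCode.card_affinePoints F K r, HermitianCode.finrank_code_one K hr δ,
    HermitianCode.exists_isMinDistance_code_one K hr δ⟩

theorem mainTheorem4 {F : Type*} [Field F] [Fintype F] [DecidableEq F] (q r : ℕ)
    (hF : Fintype.card F = q ^ 2) (hr : 1 ≤ r) (δ : F) (hδ : δ ^ (q + 1) = -1) :
    (Fintype.card (HermitianCode.AffinePoints F q r) : ℤ)
        = (q : ℤ) ^ (2 * r + 1) - (-1) ^ (r + 1) * (q : ℤ) ^ r ∧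
    Module.finrank F (HermitianCode.code q r δ 1) = r + 2 ∧
    ∃ d : ℕ, HermitianCode.IsMinDistance (HermitianCode.code q r δ 1) d ∧
      (d : ℤ) = if Even r then (q : ℤ) ^ (2 * r + 1) - (q : ℤ) ^ (2 * r - 1)
        else (q : ℤ) ^ (2 * r + 1) - (q : ℤ) ^ (2 * r - 1) - (q : ℤ) ^ r - (q : ℤ) ^ (r - 1) :=
  mainTheorem4_general q r hF hr δ
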